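/- Let $\omega_1,\dots,\omega_n$ be real numbers without nontrivial integer relations $\sum_i m_i\omega_i=0$, $m_i\in\mathbb Z$, and consider the system of $n$ oscillators $\dot x=Ax+Bu$, $|u|\le 1$, in $\mathbb R^{2n}$ with coordinates $x=(x_1,y_1,\dots,x_n,y_n)$, where $A$ is block diagonal with blocks $\begin{pmatrix}0&1\\-\omega_i^2&0\end{pmatrix}$ and $B=(0,1,\dots,0,1)^*$. For $p=(\xi_1,\eta_1,\dots,\xi_n,\eta_n)\in\mathbb R^{2n}$ put $z_i=(\eta_i^2+\omega_i^{-2}\xi_i^2)^{1/2}$ and $$H_\Omega(p)=\frac1{(2\pi)^n}\int_0^{2\pi}\!\!\dots\int_0^{2\pi}\Bigl|\sum_{i=1}^n z_i\cos\varphi_i\Bigr|\,d\varphi_1\dots d\varphi_n .$$ Let $\Omega=\{x:(p,x)\le H_\Omega(p)\text{ for all }p\}$ be the convex body with support function $H_\Omega$, and let $\rho$ be its gauge (Minkowski functional) $\rho(x)=\inf\{r>0: x\in r\Omega\}$. A momentum at $x\ne0$ is a vector $p=p(x)\neq0$ with $\rho(x)^{-1}x=\frac{\partial H_\Omega}{\partial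 p}(p)$, and the feedback control is $u(x)=-\operatorname{sign}(B,p(x))$, where any value in $[-1,1]$ is allowed when $(B,p(x))=0$. A motion under this control on an interval is an absolutely continuous curve $x(t)$ such that for almost every $t$ one has $\dot x(t)=Ax(t)+Bu$ with $u$ a value of the feedback control at $x(t)$. Then there are constants $C>0$ and $c>0$, depending only on the system (that is, on $n$ and $\omega_1,\dots,\omega_n$), such that the following holds. If $x$ is a motion under the control on a time interval $[a,a+T]$ of integer length $T\ge 0$ with $\rho(x(t))\ge C$ for all $t\in[a,a+T]$, $\rho(x(a))=M$ and $\rho(x(a+T))=N$, then $T\le c\,(M-N)$. -/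

import Mathlib

open MeasureTheory

noncomputable section

namespace Oscillators

/-- The phase space `ℝ²ⁿ` (Euclidean). Coordinate `(0, i)` is the position `xᵢ` of the `i`-th
oscillator and `(1, i)` its velocity `yᵢ`; for a momentum `p` these are the dual variables
`ξᵢ` and `ηᵢ`. -/
abbrev Phase (n : ℕ) : Type := EuclideanSpace ℝ (Fin 2 × Fin n)

variable {n : ℕ}

/-- The block diagonal matrix `A` with blocks `(0, 1; -ωᵢ², 0)`. -/
def matA (ω : Fin n → ℝ) : Matrix (Fin 2 × Fin n) (Fin 2 × Fin n) ℝ :=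
  Matrix.blockDiagonal fun i => !![0, 1; -(ω i) ^ 2, 0]

/-- The vector `B = (0, 1, …, 0, 1)`. -/
def vecB (n : ℕ) : Phase n :=
  WithLp.toLp 2 fun k => if k.1 = 1 then 1 else 0

/-- There are no nontrivial integer relations between the frequencies. -/
def NonResonant (ω : Fin n → ℝ) : Prop :=
  ∀ m : Fin n → ℤ, ∑ i, (m i : ℝ) * ω i = 0 → m = 0

/-- `zᵢ = (ηᵢ² + ωᵢ⁻² ξᵢ²)^{1/2}`. -/
def amplitude (ω : Fin n → ℝ) (p : Phase n) (i : Fin n) : ℝ :=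
  Real.sqrt (p (1, i) ^ 2 + (ω i ^ 2)⁻¹ * p (0, i) ^ 2)

/-- `H_Ω(p) = (2π)⁻ⁿ ∫_{[0,2π]ⁿ} |∑ᵢ zᵢ cos φᵢ| dφ`. -/
def supportFn (ω : Fin n → ℝ) (p : Phase n) : ℝ :=
  ((2 * Real.pi) ^ n)⁻¹ *
    ∫ φ in Set.Icc (0 : Fin n → ℝ) (fun _ => 2 * Real.pi),
      |∑ i, amplitude ω p i * Real.cos (φ i)|

/-- The convex body `Ω` whose support function is `H_Ω`. -/
def body (ω : Fin n → ℝ) : Set (Phase n) :=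
  {x | ∀ p : Phase n, inner ℝ p x ≤ supportFn ω p}

/-- The radial coordinate `ρ(x)`: for `x ≠ 0` one has `x = ρ(x) φ` with `φ ∈ ∂Ω`. -/
def rho (ω : Fin n → ℝ) (x : Phase n) : ℝ :=
  gauge (body ω) x

/-- `p` is a momentum at `x`: `p ≠ 0` and `ρ(x)⁻¹ x = ∂H_Ω/∂p (p)`. -/
def IsMomentum (ω : Fin n → ℝ) (x p : Phase n) : Prop :=
  p ≠ 0 ∧ HasGradientAt (supportFn ω) ((rho ω x)⁻¹ • x) p

/-- The values at `x` of the feedback control `u(x) = -sign (B, p(x))`. On the switching surface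
`(B, p(x)) = 0` every value in `[-1, 1]` is admitted (the sign is understood as in
discontinuous differential equations, so that sliding motions are included). -/
def feedback (ω : Fin n → ℝ) (x : Phase n) : Set ℝ :=
  {u | ∃ p, IsMomentum ω x p ∧ |u| ≤ 1 ∧
    (inner ℝ (vecB n) p ≠ 0 → u = -Real.sign (inner ℝ (vecB n) p))}

/-- `x` is a motion on `[a, b]` under the feedback control: it is absolutely continuous and
`ẋ = A x + B u` with `u ∈ feedback (x)` at almost every time. -/
def IsMotion (ω : Fin n → ℝ) (a b : ℝ) (x : ℝ → Phase n) : Prop :=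
  AbsolutelyContinuousOnInterval x a b ∧
    ∀ᵐ t : ℝ, t ∈ Set.Ioo a b → ∃ u ∈ feedback ω (x t),
      HasDerivAt x (Matrix.toEuclideanLin (matA ω) (x t) + u • vecB n) t

end Oscillators

end

noncomputable section

namespace Oscillators

variable {n : ℕ}

/-! Let `p` be a normal at `x`, scaled so that `H_Ω(p) = 1` and `(p, x) = ρ(x)`. The drift `Ax` does
not change `ρ`: `H_Ω` depends only on the amplitudes, which the adjoint flow `e^{-tA*}` preserves.
Hence the control gives `dρ/dt = -|(B, p)|` almost everywhere, and what is needed is a uniform drop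
of `ρ` over unit time (`exists_rho_drop`).

Transport a normal `p` at time `s` by the adjoint flow. Its pairing with `x(t)` changes only through
the bounded control, so it falls short of `ρ(x(t))` by `O(1)`, which is small relative to `ρ` when
`ρ` is large. Equality in the triangle inequality for `H_Ω` holds only for proportional vectors, so
normals are unique; by compactness a nearly extremal covector is close to the true normal
(`exists_normal_stability`). Thus the rate of decrease is close to `|(B, e^{-(t-s)A*}p)|`, whose
time integral is bounded below by observability (`exists_le_integral_abs_inner_coflow`). Summing the
unit drops gives the linear bound. -/

instance fact_two_pi_pos : Fact (0 < 2 * Real.pi) := ⟨Real.two_pi_pos⟩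

/-! ### The support function as a mean over the torus -/

/-- The `n`-dimensional torus `(ℝ / 2πℤ)ⁿ`. -/
abbrev Torus (n : ℕ) : Type := Fin n → AddCircle (2 * Real.pi)

/-- The cosine on the circle `ℝ / 2πℤ`. -/
def circleCos (θ : AddCircle (2 * Real.pi)) : ℝ := Real.Angle.cos θ

/-- The sine on the circle `ℝ / 2πℤ`. -/
def circleSin (θ : AddCircle (2 * Real.pi)) : ℝ := Real.Angle.sin θ

theorem continuous_circleCos : Continuous circleCos := Real.Angle.continuous_cos

theorem continuous_circleSin : Continuous circleSin := Real.Angle.continuous_sin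

@[simp] theorem circleCos_coe (t : ℝ) : circleCos (t : AddCircle (2 * Real.pi)) = Real.cos t :=
  Real.Angle.cos_coe t

@[simp] theorem circleSin_coe (t : ℝ) : circleSin (t : AddCircle (2 * Real.pi)) = Real.sin t :=
  Real.Angle.sin_coe t

theorem circleCos_add (s t : AddCircle (2 * Real.pi)) :
    circleCos (s + t) = circleCos s * circleCos t - circleSin s * circleSin t :=
  Real.Angle.cos_add s t

/-- The linear form `p ↦ ∑ᵢ (ηᵢ cos θᵢ + ωᵢ⁻¹ ξᵢ sin θᵢ)` attached to a point of the torus. -/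
def phaseForm (ω : Fin n → ℝ) (p : Phase n) (θ : Torus n) : ℝ :=
  ∑ i, (p (1, i) * circleCos (θ i) + (ω i)⁻¹ * p (0, i) * circleSin (θ i))

theorem continuous_phaseForm_uncurry (ω : Fin n → ℝ) :
    Continuous fun q : Phase n × Torus n => phaseForm ω q.1 q.2 := by
  unfold phaseForm
  have hc := continuous_circleCos
  have hs := continuous_circleSin
  fun_prop

theorem continuous_phaseForm (ω : Fin n → ℝ) (p : Phase n) : Continuous (phaseForm ω p) :=
  (continuous_phaseForm_uncurry ω).comp (by fun_prop : Continuous fun θ => (p, θ))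

theorem phaseForm_add (ω : Fin n → ℝ) (p q : Phase n) (θ : Torus n) :
    phaseForm ω (p + q) θ = phaseForm ω p θ + phaseForm ω q θ := by
  simp only [phaseForm, ← Finset.sum_add_distrib, PiLp.add_apply]
  exact Finset.sum_congr rfl fun i _ => by ring

theorem phaseForm_smul (ω : Fin n → ℝ) (r : ℝ) (p : Phase n) (θ : Torus n) :
    phaseForm ω (r • p) θ = r * phaseForm ω p θ := by
  simp only [phaseForm, Finset.mul_sum, PiLp.smul_apply, smul_eq_mul]
  exact Finset.sum_congr rfl fun i _ => by ring

/-- The integral over the cube `[0, 2π]ⁿ` of a function on the torus is its integral over the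
torus. -/
theorem integral_cube_eq_integral_torus (F : Torus n → ℝ) (hF : Continuous F) :
    ∫ φ in Set.Icc (0 : Fin n → ℝ) (fun _ => 2 * Real.pi), F (fun i => (φ i : AddCircle _)) =
      ∫ θ, F θ := by
  have h := measurePreserving_pi _ _
    (fun _ : Fin n => AddCircle.measurePreserving_mk (2 * Real.pi) 0)
  have h1 : (∫ θ, F θ) = ∫ φ, F (fun i => (φ i : AddCircle (2 * Real.pi)))
      ∂(Measure.pi fun _ : Fin n => (volume.restrict (Set.Ioc (0 : ℝ) (0 + 2 * Real.pi)))) := by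
    rw [volume_pi, ← h.map_eq, integral_map h.measurable.aemeasurable
      hF.aestronglyMeasurable]
  rw [h1, ← Measure.restrict_pi_pi, ← volume_pi]
  apply setIntegral_congr_set
  rw [zero_add]
  exact (Measure.univ_pi_Ioc_ae_eq_Icc (f := fun _ : Fin n => (0 : ℝ))
    (g := fun _ => 2 * Real.pi)).symm

/-- Polar coordinates of the `i`-th component of a momentum. -/
theorem exists_phase (ω : Fin n → ℝ) (p : Phase n) : ∃ α : Fin n → ℝ, ∀ i,
    p (1, i) = amplitude ω p i * Real.cos (α i) ∧
      (ω i)⁻¹ * p (0, i) = amplitude ω p i * Real.sin (α i) := by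
  refine ⟨fun i => Complex.arg ⟨p (1, i), (ω i)⁻¹ * p (0, i)⟩, fun i => ?_⟩
  have h : amplitude ω p i = ‖(⟨p (1, i), (ω i)⁻¹ * p (0, i)⟩ : ℂ)‖ := by
    rw [Complex.norm_eq_sqrt_sq_add_sq, amplitude, mul_pow, inv_pow]
  rw [h, Complex.norm_mul_cos_arg, Complex.norm_mul_sin_arg]
  exact ⟨rfl, rfl⟩

/-- Shifting each angle by the polar angle of `(ηᵢ, ωᵢ⁻¹ξᵢ)` removes the sine terms. By translation
invariance the mean of the absolute value then depends on amplitudes alone. -/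
theorem phaseForm_add_phase {ω : Fin n → ℝ} {p : Phase n} {α : Fin n → ℝ}
    (hα : ∀ i, p (1, i) = amplitude ω p i * Real.cos (α i) ∧
      (ω i)⁻¹ * p (0, i) = amplitude ω p i * Real.sin (α i)) (θ : Torus n) :
    phaseForm ω p (θ + fun i => (α i : AddCircle (2 * Real.pi))) =
      ∑ i, amplitude ω p i * circleCos (θ i) := by
  refine Finset.sum_congr rfl fun i _ => ?_
  have hs : ∀ s t : AddCircle (2 * Real.pi),
      circleSin (s + t) = circleSin s * circleCos t + circleCos s * circleSin t :=
    fun s t => Real.Angle.sin_add s t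
  rw [(hα i).1, (hα i).2, Pi.add_apply, circleCos_add, hs, circleCos_coe, circleSin_coe]
  linear_combination amplitude ω p i * circleCos (θ i) * Real.sin_sq_add_cos_sq (α i)

/-- The support function as the mean over the torus of absolute values of linear forms. -/
theorem supportFn_eq (ω : Fin n → ℝ) (p : Phase n) :
    supportFn ω p = ((2 * Real.pi) ^ n)⁻¹ * ∫ θ : Torus n, |phaseForm ω p θ| := by
  obtain ⟨α, hα⟩ := exists_phase ω p
  rw [← integral_add_right_eq_self _ (fun i => (α i : AddCircle (2 * Real.pi)))]
  simp_rw [phaseForm_add_phase hα]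
  rw [← integral_cube_eq_integral_torus _ (by have := continuous_circleCos; fun_prop)]
  simp [supportFn]

theorem integrable_torus {F : Torus n → ℝ} (hF : Continuous F) : Integrable F :=
  hF.integrable_of_hasCompactSupport (HasCompactSupport.of_compactSpace F)

/-! ### `H_Ω` is a norm -/

theorem supportFn_smul (ω : Fin n → ℝ) (r : ℝ) (p : Phase n) :
    supportFn ω (r • p) = |r| * supportFn ω p := by
  simp_rw [supportFn_eq, phaseForm_smul, abs_mul]
  rw [integral_const_mul]
  ring

theorem supportFn_add_le (ω : Fin n → ℝ) (p q : Phase n) :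
    supportFn ω (p + q) ≤ supportFn ω p + supportFn ω q := by
  simp_rw [supportFn_eq, phaseForm_add]
  rw [← mul_add, ← integral_add (integrable_torus (continuous_phaseForm ω p).abs)
    (integrable_torus (continuous_phaseForm ω q).abs)]
  have hp := continuous_phaseForm ω p
  have hq := continuous_phaseForm ω q
  gcongr
  · exact integrable_torus (by fun_prop)
  · exact integrable_torus (by fun_prop)
  · exact fun θ => abs_add_le _ _

theorem supportFn_nonneg (ω : Fin n → ℝ) (p : Phase n) : 0 ≤ supportFn ω p := by
  rw [supportFn_eq]
  positivity

theorem continuous_supportFn (ω : Fin n → ℝ) : Continuous (supportFn ω) := by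
  simp_rw [funext (supportFn_eq ω)]
  refine continuous_const.mul ?_
  have h := continuous_parametric_integral_of_continuous (μ := (volume : Measure (Torus n)))
    (f := fun p θ => |phaseForm ω p θ|) (continuous_phaseForm_uncurry ω).abs isCompact_univ
  simpa using h

/-- A nonnegative continuous function on the torus with integral zero vanishes. -/
theorem eq_zero_of_integral_torus_eq_zero {F : Torus n → ℝ} (hF : Continuous F)
    (h0 : ∀ θ, 0 ≤ F θ) (h : ∫ θ, F θ = 0) : F = 0 := by
  rw [integral_eq_zero_iff_of_nonneg h0 (integrable_torus hF)] at h
  exact (hF.ae_eq_iff_eq volume continuous_zero).1 h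

theorem amplitude_nonneg (ω : Fin n → ℝ) (p : Phase n) (i : Fin n) : 0 ≤ amplitude ω p i :=
  Real.sqrt_nonneg _

theorem eq_zero_of_amplitude_eq_zero {ω : Fin n → ℝ} (hω : ∀ i, ω i ≠ 0) {p : Phase n}
    (h : ∀ i, amplitude ω p i = 0) : p = 0 := by
  obtain ⟨α, hα⟩ := exists_phase ω p
  ext ⟨k, i⟩
  have h1 := hα i
  rw [h i] at h1
  fin_cases k
  · simpa [hω i] using h1.2
  · simpa using h1.1

theorem eq_zero_of_phaseForm_eq_zero {ω : Fin n → ℝ} (hω : ∀ i, ω i ≠ 0) {p : Phase n}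
    (h : ∀ θ, phaseForm ω p θ = 0) : p = 0 := by
  obtain ⟨α, hα⟩ := exists_phase ω p
  have h1 := phaseForm_add_phase hα (fun _ => ((0 : ℝ) : AddCircle (2 * Real.pi)))
  rw [h] at h1
  simp only [circleCos_coe, Real.cos_zero, mul_one] at h1
  rw [eq_comm, Finset.sum_eq_zero_iff_of_nonneg fun i _ => amplitude_nonneg ω p i] at h1
  exact eq_zero_of_amplitude_eq_zero hω fun i => h1 i (Finset.mem_univ i)

theorem supportFn_pos {ω : Fin n → ℝ} (hω : ∀ i, ω i ≠ 0) {p : Phase n} (hp : p ≠ 0) :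
    0 < supportFn ω p := by
  refine (supportFn_nonneg ω p).lt_of_ne' fun h => hp ?_
  rw [supportFn_eq, mul_eq_zero, or_iff_right (by positivity)] at h
  have h1 := eq_zero_of_integral_torus_eq_zero (continuous_phaseForm ω p).abs
    (fun _ => abs_nonneg _) h
  exact eq_zero_of_phaseForm_eq_zero hω fun θ => abs_eq_zero.1 (congrFun h1 θ)

/-! ### Equality in the triangle inequality -/

/-- The gap in the pointwise triangle inequality is continuous, nonnegative and of integral zero, so
it vanishes everywhere, not just almost everywhere. -/
theorem phaseForm_mul_nonneg_of_supportFn_add {ω : Fin n → ℝ} {p q : Phase n}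
    (h : supportFn ω (p + q) = supportFn ω p + supportFn ω q) (θ : Torus n) :
    0 ≤ phaseForm ω p θ * phaseForm ω q θ := by
  have hp := continuous_phaseForm ω p
  have hq := continuous_phaseForm ω q
  simp_rw [supportFn_eq, phaseForm_add] at h
  rw [← mul_add, ← integral_add (integrable_torus hp.abs) (integrable_torus hq.abs),
    mul_right_inj' (by positivity), eq_comm, ← sub_eq_zero,
    ← integral_sub (integrable_torus (by fun_prop)) (integrable_torus (by fun_prop))] at h
  have h1 := congrFun (eq_zero_of_integral_torus_eq_zero (by fun_prop)
    (fun θ => sub_nonneg.2 (abs_add_le _ _)) h) θ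
  have h2 := (abs_add_eq_add_abs_iff _ _).1 (sub_eq_zero.1 h1).symm
  rcases h2 with h2 | h2
  · exact mul_nonneg h2.1 h2.2
  · exact mul_nonneg_of_nonpos_of_nonpos h2.1 h2.2

open Filter Topology in
/-- If `∑ zᵢ cos ψᵢ` and `∑ (aᵢ cos ψᵢ + bᵢ sin ψᵢ)` never have opposite signs, then `b = 0`. -/
theorem sin_coeff_eq_zero {z a b : Fin n → ℝ} (hz : z ≠ 0)
    (h : ∀ ψ : Fin n → ℝ, 0 ≤ (∑ i, z i * Real.cos (ψ i)) *
      ∑ i, (a i * Real.cos (ψ i) + b i * Real.sin (ψ i))) : b = 0 := by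
  have hZ : 0 < ∑ i, z i * z i := by
    obtain ⟨j, hj⟩ := Function.ne_iff.1 hz
    exact Finset.sum_pos' (fun i _ => mul_self_nonneg _)
      ⟨j, Finset.mem_univ j, mul_self_pos.2 hj⟩
  have hsmall : ∀ᶠ s : ℝ in 𝓝 0, ∀ i, |s * z i| < 1 := by
    refine eventually_all.2 fun i => ?_
    have : Tendsto (fun s : ℝ => |s * z i|) (𝓝 0) (𝓝 |0 * z i|) :=
      Continuous.tendsto (by fun_prop) 0
    exact this.eventually_lt_const (by simp)
  have hg : ∀ᶠ s : ℝ in 𝓝[>] 0,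
      0 ≤ ∑ i, (a i * (s * z i) - |b i| * √(1 - (s * z i) ^ 2)) := by
    filter_upwards [hsmall.filter_mono nhdsWithin_le_nhds, self_mem_nhdsWithin] with s hs hs0
    -- Angles with `cos ψᵢ = s zᵢ` make the first factor `s ∑ zᵢ² > 0`; the signs make every sine
    -- term `-|bᵢ|√(1 - (s zᵢ)²)`. As `s → 0⁺`, the second factor tends to `-∑ |bᵢ| ≥ 0`.
    have h1 := h fun i => (if 0 ≤ b i then -1 else 1) * Real.arccos (s * z i)
    have hc : ∀ i, Real.cos ((if 0 ≤ b i then -1 else 1) * Real.arccos (s * z i)) = s * z i := by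
      intro i
      have := Real.cos_arccos (abs_le.1 (hs i).le).1 (abs_le.1 (hs i).le).2
      split_ifs <;> simpa using this
    have hb : ∀ i, b i * Real.sin ((if 0 ≤ b i then -1 else 1) * Real.arccos (s * z i)) =
        -|b i| * √(1 - (s * z i) ^ 2) := by
      intro i
      rw [← Real.sin_arccos]
      split_ifs with hi
      · rw [abs_of_nonneg hi]; simp
      · rw [abs_of_neg (not_le.1 hi)]; simp
    simp_rw [hc, hb] at h1
    have h2 : ∑ i, z i * (s * z i) = s * ∑ i, z i * z i := by
      rw [Finset.mul_sum]; exact Finset.sum_congr rfl fun i _ => by ring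
    rw [h2] at h1
    have h3 := nonneg_of_mul_nonneg_right h1 (mul_pos hs0 hZ)
    refine h3.trans_eq (Finset.sum_congr rfl fun i _ => by ring)
  have hlim : Tendsto (fun s : ℝ => ∑ i, (a i * (s * z i) - |b i| * √(1 - (s * z i) ^ 2)))
      (𝓝[>] 0) (𝓝 (∑ i, (a i * (0 * z i) - |b i| * √(1 - (0 * z i) ^ 2)))) :=
    (Continuous.tendsto (by fun_prop) 0).mono_left nhdsWithin_le_nhds
  have h4 := ge_of_tendsto hlim hg
  simp only [zero_mul, mul_zero, zero_sub, ne_eq, OfNat.ofNat_ne_zero, not_false_eq_true, zero_pow,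
    sub_zero, Real.sqrt_one, mul_one, Finset.sum_neg_distrib, Left.nonneg_neg_iff] at h4
  have h5 := (Finset.sum_eq_zero_iff_of_nonneg fun i _ => abs_nonneg (b i)).1
    (le_antisymm h4 (Finset.sum_nonneg fun i _ => abs_nonneg (b i)))
  exact funext fun i => abs_eq_zero.1 (h5 i (Finset.mem_univ i))

/-- If two linear forms never have opposite signs on the cube, they are proportional. -/
theorem proportional_of_mul_nonneg_cube {z a : Fin n → ℝ} (hz : z ≠ 0)
    (h : ∀ ψ : Fin n → ℝ, 0 ≤ (∑ i, z i * Real.cos (ψ i)) * ∑ i, a i * Real.cos (ψ i)) :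
    ∃ r : ℝ, a = r • z := by
  -- Homogeneity extends the sign condition from the cube to all vectors.
  have hall : ∀ c : Fin n → ℝ, 0 ≤ (∑ i, z i * c i) * ∑ i, a i * c i := by
    intro c
    set N : ℝ := 1 + ‖c‖
    have hN : 0 < N := by positivity
    have hcN : ∀ i, |c i / N| ≤ 1 := fun i => by
      rw [abs_div, abs_of_pos hN, div_le_one hN]
      have := norm_le_pi_norm c i
      rw [Real.norm_eq_abs] at this
      linarith
    have h1 := h fun i => Real.arccos (c i / N)
    simp_rw [fun i => Real.cos_arccos (abs_le.1 (hcN i)).1 (abs_le.1 (hcN i)).2, ← mul_div_assoc,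
      ← Finset.sum_div] at h1
    rw [div_mul_div_comm] at h1
    have := mul_nonneg h1 (mul_pos hN hN).le
    rwa [div_mul_cancel₀ _ (mul_pos hN hN).ne'] at this
  set Z := ∑ i, z i * z i with hZdef
  set D := ∑ i, a i * z i with hDdef
  set Q := ∑ i, a i * a i with hQdef
  have hZ : 0 < Z := by
    obtain ⟨j, hj⟩ := Function.ne_iff.1 hz
    exact Finset.sum_pos' (fun i _ => mul_self_nonneg _)
      ⟨j, Finset.mem_univ j, mul_self_pos.2 hj⟩
  -- Testing on `c = x z + a` gives `(xZ + D)(xD + Q) ≥ 0`. The discriminant of this quadratic is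
  -- `(ZQ - D²)²`, so it must vanish: the equality case of Cauchy–Schwarz.
  have hquad : ∀ x : ℝ, 0 ≤ Z * D * (x * x) + (Z * Q + D ^ 2) * x + D * Q := by
    intro x
    have h1 := hall fun i => x * z i + a i
    have e1 : ∑ i, z i * (x * z i + a i) = x * Z + D := by
      rw [hZdef, hDdef, Finset.mul_sum, ← Finset.sum_add_distrib]
      exact Finset.sum_congr rfl fun i _ => by ring
    have e2 : ∑ i, a i * (x * z i + a i) = x * D + Q := by
      rw [hQdef, hDdef, Finset.mul_sum, ← Finset.sum_add_distrib]
      exact Finset.sum_congr rfl fun i _ => by ring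
    rw [e1, e2] at h1
    linarith
  have hdisc := discrim_le_zero hquad
  have hZQ : Z * Q - D ^ 2 = 0 := by
    rw [← sq_eq_zero_iff]
    refine le_antisymm ?_ (sq_nonneg _)
    rw [discrim] at hdisc
    linarith
  refine ⟨D / Z, funext fun i => ?_⟩
  have hsum : ∑ i, (a i - D / Z * z i) ^ 2 = 0 := by
    have : ∑ i, (a i - D / Z * z i) ^ 2 = Q - 2 * (D / Z) * D + (D / Z) ^ 2 * Z := by
      rw [hZdef, hDdef, hQdef, Finset.mul_sum, Finset.mul_sum, ← Finset.sum_sub_distrib,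
        ← Finset.sum_add_distrib]
      exact Finset.sum_congr rfl fun i _ => by ring
    rw [this]
    field_simp
    linarith
  have := (Finset.sum_eq_zero_iff_of_nonneg fun i _ => sq_nonneg _).1 hsum i (Finset.mem_univ i)
  simpa [sub_eq_zero] using this

/-- Equality in the triangle inequality for `H_Ω` forces proportionality. -/
theorem proportional_of_supportFn_add {ω : Fin n → ℝ} (hω : ∀ i, ω i ≠ 0) {p q : Phase n}
    (hp : p ≠ 0) (h : supportFn ω (p + q) = supportFn ω p + supportFn ω q) :
    ∃ r : ℝ, q = r • p := by
  obtain ⟨α, hα⟩ := exists_phase ω p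
  set z := amplitude ω p
  have hz : z ≠ 0 := fun h0 => hp (eq_zero_of_amplitude_eq_zero hω (congrFun h0))
  -- `a` and `b` are the cosine and sine coefficients of the form of `q` in the angles that reduce
  -- the form of `p` to pure cosines.
  set a : Fin n → ℝ := fun i => q (1, i) * Real.cos (α i) + (ω i)⁻¹ * q (0, i) * Real.sin (α i)
  set b : Fin n → ℝ := fun i => (ω i)⁻¹ * q (0, i) * Real.cos (α i) - q (1, i) * Real.sin (α i)
  have hψ : ∀ ψ : Fin n → ℝ, 0 ≤ (∑ i, z i * Real.cos (ψ i)) *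
      ∑ i, (a i * Real.cos (ψ i) + b i * Real.sin (ψ i)) := by
    intro ψ
    have h1 := phaseForm_mul_nonneg_of_supportFn_add h
      ((fun i => (ψ i : AddCircle (2 * Real.pi))) + fun i => (α i : AddCircle (2 * Real.pi)))
    rw [phaseForm_add_phase hα] at h1
    simp only [circleCos_coe] at h1
    convert h1 using 2
    refine Finset.sum_congr rfl fun i _ => ?_
    rw [Pi.add_apply, ← AddCircle.coe_add, circleCos_coe, circleSin_coe, Real.cos_add,
      Real.sin_add]
    ring
  have hb := sin_coeff_eq_zero hz hψ
  simp only [hb, Pi.zero_apply, zero_mul, add_zero] at hψ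
  obtain ⟨r, hr⟩ := proportional_of_mul_nonneg_cube hz hψ
  refine ⟨r, ?_⟩
  ext ⟨k, i⟩
  have hbi : (ω i)⁻¹ * q (0, i) * Real.cos (α i) - q (1, i) * Real.sin (α i) = 0 := congrFun hb i
  have hai : q (1, i) * Real.cos (α i) + (ω i)⁻¹ * q (0, i) * Real.sin (α i) = r * z i :=
    congrFun hr i
  have hsc := Real.sin_sq_add_cos_sq (α i)
  fin_cases k
  · have : (ω i)⁻¹ * q (0, i) = (ω i)⁻¹ * (r * p (0, i)) := by
      linear_combination Real.cos (α i) * hbi + Real.sin (α i) * hai - r * (hα i).2 -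
        (ω i)⁻¹ * q (0, i) * hsc
    simpa using mul_left_cancel₀ (inv_ne_zero (hω i)) this
  · have : q (1, i) = r * p (1, i) := by
      linear_combination - Real.sin (α i) * hbi + Real.cos (α i) * hai - r * (hα i).1 -
        q (1, i) * hsc
    simpa using this

/-! ### The body, its gauge and stability of normals -/

/-- A boundary point of the body has at most one normalized outer normal. -/
theorem normal_unique {ω : Fin n → ℝ} (hω : ∀ i, ω i ≠ 0) {y p q : Phase n} (hy : y ∈ body ω)
    (hp : supportFn ω p = 1) (hq : supportFn ω q = 1) (hpy : inner ℝ p y = 1)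
    (hqy : 1 ≤ inner ℝ q y) : p = q := by
  have hp0 : p ≠ 0 := by
    rintro rfl
    simp at hpy
  have h1 : inner ℝ (p + q) y ≤ supportFn ω (p + q) := hy (p + q)
  rw [inner_add_left] at h1
  have h2 := supportFn_add_le ω p q
  have h3 : supportFn ω (p + q) = 2 := by linarith
  obtain ⟨r, rfl⟩ := proportional_of_supportFn_add hω hp0 (by linarith)
  rw [supportFn_smul, hp, mul_one] at hq
  rw [show p + r • p = (1 + r) • p by rw [add_smul, one_smul], supportFn_smul, hp, mul_one] at h3
  have : r = 1 := by
    -- `r = -1` would give `p + q = 0`, against `H_Ω(p + q) = 2`.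
    rcases eq_or_eq_neg_of_abs_eq hq with h | h
    · exact h
    · rw [h] at h3; norm_num at h3
  rw [this, one_smul]

theorem exists_mul_norm_le_supportFn {ω : Fin n → ℝ} (hω : ∀ i, ω i ≠ 0) :
    ∃ k > 0, ∀ p : Phase n, k * ‖p‖ ≤ supportFn ω p := by
  obtain ⟨k, hk, h⟩ := (isCompact_sphere (0 : Phase n) 1).exists_forall_le'
    (continuous_supportFn ω).continuousOn (a := 0)
    (fun p hp => supportFn_pos hω (ne_zero_of_mem_unit_sphere ⟨p, hp⟩))
  refine ⟨k, hk, fun p => ?_⟩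
  rcases eq_or_ne p 0 with rfl | hp
  · simpa using supportFn_nonneg ω (0 : Phase n)
  · have h1 := h (‖p‖⁻¹ • p) (by simp [norm_smul, hp])
    have hp' := norm_pos_iff.2 hp
    rw [supportFn_smul, abs_of_pos (inv_pos.2 hp'), inv_mul_eq_div, le_div_iff₀ hp'] at h1
    exact h1

theorem exists_supportFn_le_mul_norm (ω : Fin n → ℝ) :
    ∃ K, ∀ p : Phase n, supportFn ω p ≤ K * ‖p‖ := by
  obtain ⟨K, h⟩ := (isCompact_sphere (0 : Phase n) 1).exists_bound_of_continuousOn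
    (continuous_supportFn ω).continuousOn
  refine ⟨K, fun p => ?_⟩
  rcases eq_or_ne p 0 with rfl | hp
  · simpa using (supportFn_smul ω 0 (0 : Phase n)).le
  · have h1 := (le_abs_self _).trans (h (‖p‖⁻¹ • p) (by simp [norm_smul, hp]))
    have hp' := norm_pos_iff.2 hp
    rw [supportFn_smul, abs_of_pos (inv_pos.2 hp'), inv_mul_eq_div, div_le_iff₀ hp'] at h1
    exact h1

theorem isCompact_supportFn_eq_one {ω : Fin n → ℝ} (hω : ∀ i, ω i ≠ 0) :
    IsCompact {p : Phase n | supportFn ω p = 1} := by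
  obtain ⟨k, hk, h⟩ := exists_mul_norm_le_supportFn hω
  refine Metric.isCompact_of_isClosed_isBounded
    (isClosed_eq (continuous_supportFn ω) continuous_const)
    ((Metric.isBounded_closedBall (x := (0 : Phase n)) (r := 1 / k)).subset fun p hp => ?_)
  rw [mem_closedBall_zero_iff, le_div_iff₀ hk, mul_comm]
  exact (h p).trans_eq hp

theorem isCompact_body (ω : Fin n → ℝ) : IsCompact (body ω) := by
  obtain ⟨K, h⟩ := exists_supportFn_le_mul_norm ω
  refine Metric.isCompact_of_isClosed_isBounded ?_
    ((Metric.isBounded_closedBall (x := (0 : Phase n)) (r := max K 0)).subset fun x hx => ?_)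
  · simp only [body, Set.ofPred_forall]
    exact isClosed_iInter fun p => isClosed_le (by fun_prop) continuous_const
  · rw [mem_closedBall_zero_iff]
    rcases eq_or_ne x 0 with rfl | hx0
    · simp
    · have h1 := (hx x).trans (h x)
      rw [real_inner_self_eq_norm_mul_norm] at h1
      exact (le_of_mul_le_mul_right h1 (norm_pos_iff.2 hx0)).trans (le_max_left _ _)

theorem convex_body (ω : Fin n → ℝ) : Convex ℝ (body ω) := by
  intro x hx y hy s t hs ht hst p
  rw [inner_add_right, inner_smul_right, inner_smul_right]
  have h1 := mul_le_mul_of_nonneg_left (hx p) hs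
  have h2 := mul_le_mul_of_nonneg_left (hy p) ht
  calc _ ≤ s * supportFn ω p + t * supportFn ω p := add_le_add h1 h2
    _ = supportFn ω p := by rw [← add_mul, hst, one_mul]

theorem body_mem_nhds {ω : Fin n → ℝ} (hω : ∀ i, ω i ≠ 0) : body ω ∈ nhds 0 := by
  obtain ⟨k, hk, h⟩ := exists_mul_norm_le_supportFn hω
  refine Filter.mem_of_superset (Metric.closedBall_mem_nhds 0 hk) fun x hx p => ?_
  rw [mem_closedBall_zero_iff] at hx
  calc inner ℝ p x ≤ ‖p‖ * ‖x‖ := real_inner_le_norm _ _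
    _ ≤ ‖p‖ * k := by gcongr
    _ ≤ supportFn ω p := by rw [mul_comm]; exact h p

/-- Since `x ∈ rΩ` up to shrinking for every `r > ρ(x)`, the bound follows as `r` decreases to
`ρ(x)`. It is the global inequality for which normals are the equality case. -/
theorem inner_le_supportFn_mul_rho {ω : Fin n → ℝ} (hω : ∀ i, ω i ≠ 0) (p x : Phase n) :
    inner ℝ p x ≤ supportFn ω p * rho ω x := by
  refine ge_of_tendsto (f := fun r => supportFn ω p * r) (x := nhdsWithin (rho ω x)
    (Set.Ioi (rho ω x))) ((Continuous.tendsto (by fun_prop) _).mono_left nhdsWithin_le_nhds) ?_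
  filter_upwards [self_mem_nhdsWithin] with r hr
  obtain ⟨b, hb, hbr, y, hy, rfl⟩ :=
    exists_lt_of_gauge_lt (absorbent_nhds_zero (body_mem_nhds hω)) hr
  simp only [inner_smul_right]
  calc b * inner ℝ p y ≤ b * supportFn ω p := by gcongr; exact hy p
    _ ≤ supportFn ω p * r := by
      rw [mul_comm]; exact mul_le_mul_of_nonneg_left hbr.le (supportFn_nonneg ω p)

theorem inv_rho_smul_mem_body {ω : Fin n → ℝ} (hω : ∀ i, ω i ≠ 0) {x : Phase n}
    (hx : 0 < rho ω x) : (rho ω x)⁻¹ • x ∈ body ω := by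
  intro p
  rw [inner_smul_right, inv_mul_eq_div, div_le_iff₀ hx]
  exact inner_le_supportFn_mul_rho hω p x

theorem exists_lipschitzWith_rho {ω : Fin n → ℝ} (hω : ∀ i, ω i ≠ 0) :
    ∃ K, LipschitzWith K (rho ω) :=
  (convex_body ω).lipschitz_gauge (body_mem_nhds hω)

/-- Uniform stability of normals: a nearly extremal normalized covector is close to the normal. -/
theorem exists_normal_stability {ω : Fin n → ℝ} (hω : ∀ i, ω i ≠ 0) {ε : ℝ} (hε : 0 < ε) :
    ∃ δ > 0, ∀ y ∈ body ω, ∀ p q : Phase n, supportFn ω p = 1 → supportFn ω q = 1 →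
      inner ℝ p y = 1 → 1 - δ < inner ℝ q y → ‖p - q‖ < ε := by
  -- On the compact set of triples with `p` normal at `y` and `q` at distance at least `ε` from `p`,
  -- uniqueness of the normal makes the deficit `1 - (q, y)` positive, hence bounded below by some
  -- `δ`.
  have hK : IsCompact ((body ω ×ˢ {p : Phase n | supportFn ω p = 1} ×ˢ
      {p : Phase n | supportFn ω p = 1}) ∩
      ({w | inner ℝ w.2.1 w.1 = (1 : ℝ)} ∩ {w | ε ≤ ‖w.2.1 - w.2.2‖})) := by
    refine ((isCompact_body ω).prod ((isCompact_supportFn_eq_one hω).prod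
      (isCompact_supportFn_eq_one hω))).inter_right (IsClosed.inter ?_ ?_)
    · exact isClosed_eq (by fun_prop) continuous_const
    · exact isClosed_le continuous_const (by fun_prop)
  obtain ⟨δ, hδ, h⟩ := hK.exists_forall_le' (f := fun w => (1 : ℝ) - inner ℝ w.2.2 w.1)
    (by fun_prop) (a := 0) (by
      rintro ⟨y, p, q⟩ ⟨⟨hy, hp, hq⟩, hpy, hpq⟩
      by_contra! hcon
      obtain rfl : p = q := normal_unique hω hy hp hq hpy (by linarith)
      simp only [Set.mem_ofPred_eq, sub_self, norm_zero] at hpq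
      linarith)
  refine ⟨δ, hδ, fun y hy p q hp hq hpy hqy => ?_⟩
  by_contra! hcon
  have := h (y, p, q) ⟨⟨hy, hp, hq⟩, hpy, hcon⟩
  dsimp only at this
  linarith

/-! ### The adjoint flow on momenta -/

theorem hasDerivAt_euclidean {ι : Type*} [Fintype ι] {f : ℝ → EuclideanSpace ℝ ι}
    {f' : EuclideanSpace ℝ ι} {t : ℝ} :
    HasDerivAt f f' t ↔ ∀ k, HasDerivAt (fun s => f s k) (f' k) t := by
  rw [hasDerivAt_iff_hasFDerivAt, ← hasFDerivWithinAt_univ, hasFDerivWithinAt_euclidean]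
  refine forall_congr' fun k => ?_
  rw [hasDerivAt_iff_hasFDerivAt, hasFDerivWithinAt_univ]
  congr! 1

/-- The adjoint flow `e^{-tA*}` on momenta. -/
def coflow (ω : Fin n → ℝ) (t : ℝ) (p : Phase n) : Phase n :=
  WithLp.toLp 2 fun k =>
    if k.1 = 0 then p (0, k.2) * Real.cos (ω k.2 * t) + ω k.2 * p (1, k.2) * Real.sin (ω k.2 * t)
    else p (1, k.2) * Real.cos (ω k.2 * t) - (ω k.2)⁻¹ * p (0, k.2) * Real.sin (ω k.2 * t)

/-- The generator `-A*` of the adjoint flow. -/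
def cogenerator (ω : Fin n → ℝ) (p : Phase n) : Phase n :=
  WithLp.toLp 2 fun k => if k.1 = 0 then ω k.2 ^ 2 * p (1, k.2) else -p (0, k.2)

theorem coflow_apply_zero (ω : Fin n → ℝ) (t : ℝ) (p : Phase n) (i : Fin n) :
    coflow ω t p (0, i) = p (0, i) * Real.cos (ω i * t) + ω i * p (1, i) * Real.sin (ω i * t) := by
  simp [coflow]

theorem coflow_apply_one (ω : Fin n → ℝ) (t : ℝ) (p : Phase n) (i : Fin n) :
    coflow ω t p (1, i) =
      p (1, i) * Real.cos (ω i * t) - (ω i)⁻¹ * p (0, i) * Real.sin (ω i * t) := by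
  simp [coflow]

theorem cogenerator_apply_zero (ω : Fin n → ℝ) (p : Phase n) (i : Fin n) :
    cogenerator ω p (0, i) = ω i ^ 2 * p (1, i) := by
  simp [cogenerator]

theorem cogenerator_apply_one (ω : Fin n → ℝ) (p : Phase n) (i : Fin n) :
    cogenerator ω p (1, i) = -p (0, i) := by
  simp [cogenerator]

@[simp] theorem coflow_zero (ω : Fin n → ℝ) (p : Phase n) : coflow ω 0 p = p := by
  ext ⟨k, i⟩
  fin_cases k
  · simpa using coflow_apply_zero ω 0 p i
  · simpa using coflow_apply_one ω 0 p i

theorem continuous_coflow_uncurry (ω : Fin n → ℝ) :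
    Continuous fun q : Phase n × ℝ => coflow ω q.2 q.1 := by
  unfold coflow
  refine (PiLp.continuous_toLp 2 _).comp (continuous_pi fun k => ?_)
  split_ifs <;> fun_prop

theorem contDiff_coflow (ω : Fin n → ℝ) (p : Phase n) : ContDiff ℝ 1 fun t => coflow ω t p := by
  rw [contDiff_euclidean]
  rintro ⟨k, i⟩
  fin_cases k
  · simp only [Fin.zero_eta, coflow_apply_zero]; fun_prop
  · simp only [Fin.mk_one, coflow_apply_one]; fun_prop

theorem hasDerivAt_coflow {ω : Fin n → ℝ} (hω : ∀ i, ω i ≠ 0) (p : Phase n) (t : ℝ) :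
    HasDerivAt (fun t => coflow ω t p) (cogenerator ω (coflow ω t p)) t := by
  have hcos : ∀ i, HasDerivAt (fun t => Real.cos (ω i * t)) (-Real.sin (ω i * t) * ω i) t :=
    fun i => by simpa using ((hasDerivAt_id t).const_mul (ω i)).cos
  have hsin : ∀ i, HasDerivAt (fun t => Real.sin (ω i * t)) (Real.cos (ω i * t) * ω i) t :=
    fun i => by simpa using ((hasDerivAt_id t).const_mul (ω i)).sin
  rw [hasDerivAt_euclidean]
  rintro ⟨k, i⟩
  have := hω i
  fin_cases k
  · simp only [Fin.zero_eta, coflow_apply_zero, cogenerator_apply_zero, coflow_apply_one]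
    refine (((hcos i).const_mul (p (0, i))).add
      ((hsin i).const_mul (ω i * p (1, i)))).congr_deriv ?_
    field_simp
    ring
  · simp only [Fin.mk_one, cogenerator_apply_one, coflow_apply_zero, coflow_apply_one]
    refine (((hcos i).const_mul (p (1, i))).sub
      ((hsin i).const_mul ((ω i)⁻¹ * p (0, i)))).congr_deriv ?_
    field_simp
    ring

/-- The flow rotates each pair `(ηᵢ, ωᵢ⁻¹ξᵢ)` by the angle `ωᵢ t`. This is the source of the
invariance of `H_Ω`. -/
theorem amplitude_coflow {ω : Fin n → ℝ} (hω : ∀ i, ω i ≠ 0) (t : ℝ) (p : Phase n) (i : Fin n) :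
    amplitude ω (coflow ω t p) i = amplitude ω p i := by
  rw [amplitude, amplitude, coflow_apply_zero, coflow_apply_one]
  congr 1
  have := hω i
  have hsc := Real.sin_sq_add_cos_sq (ω i * t)
  field_simp
  linear_combination (p (1, i) ^ 2 * ω i ^ 2 + p (0, i) ^ 2) * hsc

theorem supportFn_coflow {ω : Fin n → ℝ} (hω : ∀ i, ω i ≠ 0) (t : ℝ) (p : Phase n) :
    supportFn ω (coflow ω t p) = supportFn ω p := by
  simp_rw [supportFn, amplitude_coflow hω]

theorem inner_eq_sum (p x : Phase n) :
    inner ℝ p x = ∑ i, (p (0, i) * x (0, i) + p (1, i) * x (1, i)) := by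
  rw [PiLp.inner_apply, Fintype.sum_prod_type, Fin.sum_univ_two, ← Finset.sum_add_distrib]
  exact Finset.sum_congr rfl fun i _ => by simp [mul_comm]

theorem inner_vecB (p : Phase n) : inner ℝ (vecB n) p = ∑ i, p (1, i) := by
  rw [inner_eq_sum]
  exact Finset.sum_congr rfl fun i _ => by simp [vecB]

theorem toEuclideanLin_matA_apply_zero (ω : Fin n → ℝ) (x : Phase n) (i : Fin n) :
    Matrix.toEuclideanLin (matA ω) x (0, i) = x (1, i) := by
  simp [matA, Matrix.toLpLin_apply, Matrix.mulVec, dotProduct, Fintype.sum_prod_type,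
    Matrix.blockDiagonal_apply, Fin.sum_univ_two]

theorem toEuclideanLin_matA_apply_one (ω : Fin n → ℝ) (x : Phase n) (i : Fin n) :
    Matrix.toEuclideanLin (matA ω) x (1, i) = -ω i ^ 2 * x (0, i) := by
  simp [matA, Matrix.toLpLin_apply, Matrix.mulVec, dotProduct, Fintype.sum_prod_type,
    Matrix.blockDiagonal_apply, Fin.sum_univ_two]

theorem inner_cogenerator (ω : Fin n → ℝ) (p x : Phase n) :
    inner ℝ (cogenerator ω p) x = -inner ℝ p (Matrix.toEuclideanLin (matA ω) x) := by
  rw [inner_eq_sum, inner_eq_sum, ← Finset.sum_neg_distrib]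
  refine Finset.sum_congr rfl fun i _ => ?_
  rw [toEuclideanLin_matA_apply_zero, toEuclideanLin_matA_apply_one, cogenerator_apply_zero,
    cogenerator_apply_one]
  ring

/-! ### Observability -/

theorem NonResonant.ne_zero {ω : Fin n → ℝ} (hω : NonResonant ω) (i : Fin n) : ω i ≠ 0 := by
  intro h
  have h1 := hω (Pi.single i 1) (by
    rw [Finset.sum_eq_single i] <;> simp +contextual [h])
  simpa using congrFun h1 i

/-- Equal squares would give a relation `ωᵢ ± ωⱼ = 0`. Distinct squares and nonzero frequencies are
all that observability takes from nonresonance. -/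
theorem NonResonant.injective_sq {ω : Fin n → ℝ} (hω : NonResonant ω) :
    Function.Injective fun i => -ω i ^ 2 := by
  intro i j hij
  by_contra hne
  have key : ∀ s : ℤ, ω i + s * ω j = 0 → False := by
    intro s hs
    have h1 := hω (Pi.single i 1 + Pi.single j s) (by
      simp only [Pi.add_apply, Int.cast_add, add_mul, Finset.sum_add_distrib]
      rw [Finset.sum_eq_single i (by simp +contextual) (by simp),
        Finset.sum_eq_single j (by simp +contextual) (by simp)]
      simpa using hs)
    simpa [hne] using congrFun h1 i
  rcases sq_eq_sq_iff_eq_or_eq_neg.1 (neg_injective hij) with h | h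
  · exact key (-1) (by rw [h]; simp)
  · exact key 1 (by rw [h]; simp)

theorem hasDerivAt_eq_zero_of_eqOn_zero {f : ℝ → ℝ} {f' t : ℝ} {U : Set ℝ} (hU : IsOpen U)
    (ht : t ∈ U) (h0 : ∀ s ∈ U, f s = 0) (hf : HasDerivAt f f' t) : f' = 0 :=
  hf.unique ((hasDerivAt_const t (0 : ℝ)).congr_of_eventuallyEq
    (Filter.eventually_of_mem (hU.mem_nhds ht) h0))

/-- Observability: a momentum whose coflow stays orthogonal to `B` on an open set of times is
zero. -/
theorem NonResonant.eq_zero_of_inner_coflow {ω : Fin n → ℝ} (hω : NonResonant ω) {p : Phase n}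
    {U : Set ℝ} (hU : IsOpen U) (hne : U.Nonempty)
    (h : ∀ t ∈ U, inner ℝ (vecB n) (coflow ω t p) = 0) : p = 0 := by
  have hcoord : ∀ (k : Fin 2 × Fin n) (t : ℝ),
      HasDerivAt (fun t => coflow ω t p k) (cogenerator ω (coflow ω t p) k) t :=
    fun k t => hasDerivAt_euclidean.1 (hasDerivAt_coflow hω.ne_zero p t) k
  -- Each derivative swaps the velocity and position components, and two of them produce a factor
  -- `-ωᵢ²`. All power sums with nodes `-ωᵢ²` therefore vanish, and a Vandermonde argument kills the
  -- components.
  have hstep : ∀ m : ℕ, (∀ t ∈ U, ∑ i, coflow ω t p (1, i) * (-ω i ^ 2) ^ m = 0) →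
      ∀ t ∈ U, ∑ i, coflow ω t p (0, i) * (-ω i ^ 2) ^ m = 0 := by
    intro m hm t ht
    have h1 := hasDerivAt_eq_zero_of_eqOn_zero hU ht hm (HasDerivAt.fun_sum fun i _ =>
      (hcoord (1, i) t).mul_const ((-ω i ^ 2) ^ m))
    simpa [cogenerator_apply_one] using h1
  have hall : ∀ m : ℕ, ∀ t ∈ U, ∑ i, coflow ω t p (1, i) * (-ω i ^ 2) ^ m = 0 := by
    intro m
    induction m with
    | zero => intro t ht; simpa [inner_vecB] using h t ht
    | succ m ih =>
      intro t ht
      have h1 := hasDerivAt_eq_zero_of_eqOn_zero hU ht (hstep m ih) (HasDerivAt.fun_sum fun i _ =>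
        (hcoord (0, i) t).mul_const ((-ω i ^ 2) ^ m))
      rw [← neg_eq_zero, ← Finset.sum_neg_distrib, ← h1]
      refine Finset.sum_congr rfl fun i _ => ?_
      rw [cogenerator_apply_zero]
      ring
  obtain ⟨t, ht⟩ := hne
  have h1 := Matrix.eq_zero_of_forall_pow_sum_mul_pow_eq_zero hω.injective_sq
    (v := fun i => coflow ω t p (1, i)) fun m => hall m t ht
  have h0 := Matrix.eq_zero_of_forall_pow_sum_mul_pow_eq_zero hω.injective_sq
    (v := fun i => coflow ω t p (0, i)) fun m => hstep m (hall m) t ht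
  refine eq_zero_of_amplitude_eq_zero hω.ne_zero fun i => ?_
  rw [← amplitude_coflow hω.ne_zero t, amplitude,
    show coflow ω t p (1, i) = 0 from congrFun h1 i,
    show coflow ω t p (0, i) = 0 from congrFun h0 i]
  simp

/-- Uniform observability on a time interval. -/
theorem NonResonant.exists_le_integral_abs_inner_coflow {ω : Fin n → ℝ} (hω : NonResonant ω)
    {τ : ℝ} (hτ : 0 < τ) :
    ∃ κ > 0, ∀ p : Phase n, supportFn ω p = 1 →
      κ ≤ ∫ t in (0 : ℝ)..τ, |inner ℝ (vecB n) (coflow ω t p)| := by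
  have hc : Continuous fun q : Phase n × ℝ => |inner ℝ (vecB n) (coflow ω q.2 q.1)| :=
    (continuous_const.inner (continuous_coflow_uncurry ω)).abs
  refine (isCompact_supportFn_eq_one hω.ne_zero).exists_forall_le'
    (intervalIntegral.continuous_parametric_intervalIntegral_of_continuous' hc 0 τ).continuousOn
    fun p hp => ?_
  have hcp : Continuous fun t => |inner ℝ (vecB n) (coflow ω t p)| :=
    hc.comp (by fun_prop : Continuous fun t => (p, t))
  have hp0 : p ≠ 0 := by
    rintro rfl
    have := supportFn_smul ω 0 (0 : Phase n)
    simp only [smul_zero, abs_zero, zero_mul] at this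
    rw [Set.mem_ofPred_eq, this] at hp
    exact zero_ne_one hp
  obtain ⟨t, ht, hne⟩ : ∃ t ∈ Set.Ioo 0 τ, inner ℝ (vecB n) (coflow ω t p) ≠ 0 := by
    by_contra! hcon
    exact hp0 (hω.eq_zero_of_inner_coflow isOpen_Ioo (Set.nonempty_Ioo.2 hτ) hcon)
  exact intervalIntegral.integral_pos hτ hcp.continuousOn (fun _ _ => abs_nonneg _)
    ⟨t, Set.Ioo_subset_Icc_self ht, abs_pos.2 hne⟩

/-! ### Absolutely continuous functions -/

theorem absolutelyContinuousOnInterval_lipschitz_comp {X Y : Type*} [PseudoMetricSpace X]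
    [PseudoMetricSpace Y] {g : X → Y} {K : NNReal} (hg : LipschitzWith K g) {f : ℝ → X} {a b : ℝ}
    (hf : AbsolutelyContinuousOnInterval f a b) :
    AbsolutelyContinuousOnInterval (fun t => g (f t)) a b := by
  refine squeeze_zero (fun E => Finset.sum_nonneg fun _ _ => dist_nonneg) (fun E => ?_)
    (by simpa using Filter.Tendsto.const_mul (K : ℝ) hf)
  rw [Finset.mul_sum]
  exact Finset.sum_le_sum fun i _ => hg.dist_le_mul _ _

/-- Polarization reduces the pairing to squares of norms, to which the Lipschitz and product rules
apply. -/
theorem absolutelyContinuousOnInterval_inner {E : Type*} [NormedAddCommGroup E]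
    [InnerProductSpace ℝ E] {f g : ℝ → E} {a b : ℝ} (hf : AbsolutelyContinuousOnInterval f a b)
    (hg : AbsolutelyContinuousOnInterval g a b) :
    AbsolutelyContinuousOnInterval (fun t => inner ℝ (f t) (g t)) a b := by
  have h1 := absolutelyContinuousOnInterval_lipschitz_comp lipschitzWith_one_norm (hf.fun_add hg)
  have h2 := absolutelyContinuousOnInterval_lipschitz_comp lipschitzWith_one_norm (hf.fun_sub hg)
  convert ((h1.fun_mul h1).fun_sub (h2.fun_mul h2)).const_mul (1 / 4) using 2 with t
  rw [norm_add_mul_self_real, norm_sub_mul_self_real]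
  ring

/-- Integration of an almost everywhere upper bound for the derivative. -/
theorem sub_le_integral_of_ae_deriv_le {f g : ℝ → ℝ} {a b : ℝ} (hab : a ≤ b)
    (hf : AbsolutelyContinuousOnInterval f a b) (hg : Continuous g)
    (h : ∀ᵐ t, t ∈ Set.Ioo a b → deriv f t ≤ g t) : f b - f a ≤ ∫ t in a..b, g t := by
  rw [← hf.integral_deriv_eq_sub]
  refine intervalIntegral.integral_mono_ae_restrict hab hf.intervalIntegrable_deriv
    (hg.intervalIntegrable a b) ?_
  rw [← restrict_Ioo_eq_restrict_Icc]
  exact (ae_restrict_iff' measurableSet_Ioo).2 h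

/-! ### Normals and the decrease of `ρ` along motions -/

theorem supportFn_inv_smul {ω : Fin n → ℝ} {p : Phase n} (hp : 0 < supportFn ω p) :
    supportFn ω ((supportFn ω p)⁻¹ • p) = 1 := by
  rw [supportFn_smul, abs_of_pos (inv_pos.2 hp), inv_mul_cancel₀ hp.ne']

/-- Euler's identity for the degree-one homogeneous function `H_Ω`. -/
theorem inner_gradient_supportFn {ω : Fin n → ℝ} {p g : Phase n}
    (h : HasGradientAt (supportFn ω) g p) : inner ℝ p g = supportFn ω p := by
  have hline : HasDerivAt (fun s : ℝ => s • p) p 1 := by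
    simpa using (hasDerivAt_id (1 : ℝ)).smul_const p
  have h' : HasFDerivAt (supportFn ω) (InnerProductSpace.toDual ℝ (Phase n) g) ((1 : ℝ) • p) := by
    rw [one_smul]; exact h.hasFDerivAt
  have h1 := h'.comp_hasDerivAt 1 hline
  have h2 : HasDerivAt (fun s : ℝ => s * supportFn ω p) (supportFn ω p) 1 := by
    simpa using (hasDerivAt_id (1 : ℝ)).mul_const (supportFn ω p)
  have h3 : (supportFn ω ∘ fun s : ℝ => s • p) =ᶠ[nhds 1] fun s => s * supportFn ω p := by
    filter_upwards [lt_mem_nhds (zero_lt_one' ℝ)] with s hs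
    rw [Function.comp_apply, supportFn_smul, abs_of_pos hs]
  have h4 := h1.unique (h2.congr_of_eventuallyEq h3)
  rwa [InnerProductSpace.toDual_apply_apply, real_inner_comm] at h4

/-- `p` is a normalized outer normal to the level set of `ρ` through `x`. -/
def IsNormal (ω : Fin n → ℝ) (x p : Phase n) : Prop :=
  supportFn ω p = 1 ∧ inner ℝ p x = rho ω x

/-- Euler's identity turns the gradient condition into extremality, so after rescaling the momentum
is a normal. The product form of the sign law also covers the switching surface, where both sides
vanish. -/
theorem exists_isNormal_of_mem_feedback {ω : Fin n → ℝ} (hω : ∀ i, ω i ≠ 0) {x : Phase n}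
    (hx : 0 < rho ω x) {u : ℝ} (hu : u ∈ feedback ω x) :
    |u| ≤ 1 ∧ ∃ p, IsNormal ω x p ∧
      u * inner ℝ (vecB n) p = -|inner ℝ (vecB n) p| := by
  obtain ⟨p, ⟨hp0, hp⟩, hu1, hsign⟩ := hu
  have hH := supportFn_pos hω hp0
  have heuler := inner_gradient_supportFn hp
  rw [inner_smul_right, inv_mul_eq_div, div_eq_iff hx.ne'] at heuler
  refine ⟨hu1, (supportFn ω p)⁻¹ • p, ⟨supportFn_inv_smul hH, ?_⟩, ?_⟩
  · rw [real_inner_smul_left, heuler, inv_mul_cancel_left₀ hH.ne']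
  · rw [inner_smul_right, abs_mul, abs_of_pos (inv_pos.2 hH)]
    rcases eq_or_ne (inner ℝ (vecB n) p) 0 with h0 | h0
    · simp [h0]
    · rw [hsign h0]
      have : Real.sign (inner ℝ (vecB n) p) * inner ℝ (vecB n) p = |inner ℝ (vecB n) p| := by
        rcases lt_or_gt_of_ne h0 with h | h
        · rw [Real.sign_of_neg h, abs_of_neg h]; ring
        · rw [Real.sign_of_pos h, abs_of_pos h]; ring
      linear_combination -(supportFn ω p)⁻¹ * this

/-- The free motion is tangent to the level sets of `ρ`. -/
theorem IsNormal.inner_matA {ω : Fin n → ℝ} (hω : ∀ i, ω i ≠ 0) {x p : Phase n}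
    (h : IsNormal ω x p) : inner ℝ p (Matrix.toEuclideanLin (matA ω) x) = 0 := by
  -- The flow preserves `H_Ω(p) = 1`, so no transported covector pairs with `x` to more than `ρ(x)`,
  -- the value attained at time zero.
  have hmax : IsLocalMax (fun t => inner ℝ (coflow ω t p) x) 0 := by
    refine Filter.Eventually.of_forall fun t => ?_
    have := inner_le_supportFn_mul_rho hω (coflow ω t p) x
    rw [supportFn_coflow hω, h.1, one_mul] at this
    simpa [h.2] using this
  have hd := (hasDerivAt_coflow hω p 0).inner ℝ (hasDerivAt_const (0 : ℝ) x)
  have h0 := hmax.hasDerivAt_eq_zero hd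
  simpa [inner_cogenerator] using h0

/-- The function `ρ(x(s)) - (p, x(s))` is nonnegative and vanishes at `s = t`, so its derivative
there is zero. No differentiability of `ρ` itself is needed. -/
theorem IsNormal.deriv_rho_comp {ω : Fin n → ℝ} (hω : ∀ i, ω i ≠ 0) {x : ℝ → Phase n}
    {x' p : Phase n} {t : ℝ} (h : IsNormal ω (x t) p) (hx : HasDerivAt x x' t)
    (hd : DifferentiableAt ℝ (fun s => rho ω (x s)) t) :
    deriv (fun s => rho ω (x s)) t = inner ℝ p x' := by
  have hmin : IsLocalMin (fun s => rho ω (x s) - inner ℝ p (x s)) t := by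
    refine Filter.Eventually.of_forall fun s => ?_
    have := inner_le_supportFn_mul_rho hω p (x s)
    rw [h.1, one_mul] at this
    dsimp only
    rw [h.2, sub_self]
    exact sub_nonneg.2 this
  have hi := (hasDerivAt_const t p).inner ℝ hx
  have := hmin.hasDerivAt_eq_zero (hd.hasDerivAt.sub hi)
  simp only [inner_zero_left, add_zero] at this
  linarith

theorem IsMotion.absolutelyContinuous_rho {ω : Fin n → ℝ} (hω : ∀ i, ω i ≠ 0) {a b : ℝ}
    {x : ℝ → Phase n} (hx : IsMotion ω a b x) :
    AbsolutelyContinuousOnInterval (fun t => rho ω (x t)) a b := by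
  obtain ⟨K, hK⟩ := exists_lipschitzWith_rho hω
  exact absolutelyContinuousOnInterval_lipschitz_comp hK hx.1

theorem IsMotion.mono {ω : Fin n → ℝ} {a b c d : ℝ} {x : ℝ → Phase n} (hx : IsMotion ω a b x)
    (hac : a ≤ c) (hcd : c ≤ d) (hdb : d ≤ b) : IsMotion ω c d x := by
  refine ⟨hx.1.mono ?_, ?_⟩
  · rw [Set.uIcc_of_le hcd, Set.uIcc_of_le (hac.trans (hcd.trans hdb))]
    exact Set.Icc_subset_Icc hac hdb
  · filter_upwards [hx.2] with t ht htcd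
    exact ht (Set.Ioo_subset_Ioo hac hdb htcd)

/-- The rate of decrease of `ρ` along a motion. -/
theorem IsMotion.ae_deriv_rho {ω : Fin n → ℝ} (hω : ∀ i, ω i ≠ 0) {a b : ℝ} {x : ℝ → Phase n}
    (hx : IsMotion ω a b x) (hpos : ∀ t ∈ Set.Icc a b, 0 < rho ω (x t)) :
    ∀ᵐ t, t ∈ Set.Ioo a b → ∃ p, IsNormal ω (x t) p ∧
      deriv (fun s => rho ω (x s)) t = -|inner ℝ (vecB n) p| := by
  filter_upwards [hx.2, (hx.absolutelyContinuous_rho hω).ae_differentiableAt] with t ht hd htab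
  obtain ⟨u, hu, hxt⟩ := ht htab
  obtain ⟨-, p, hp, hup⟩ := exists_isNormal_of_mem_feedback hω
    (hpos t (Set.Ioo_subset_Icc_self htab)) hu
  refine ⟨p, hp, ?_⟩
  rw [hp.deriv_rho_comp hω hxt (hd (Set.Icc_subset_uIcc (Set.Ioo_subset_Icc_self htab))),
    inner_add_right, hp.inner_matA hω, zero_add, inner_smul_right, real_inner_comm, hup]

theorem IsMotion.rho_le {ω : Fin n → ℝ} (hω : ∀ i, ω i ≠ 0) {a b : ℝ} (hab : a ≤ b)
    {x : ℝ → Phase n} (hx : IsMotion ω a b x) (hpos : ∀ t ∈ Set.Icc a b, 0 < rho ω (x t)) :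
    rho ω (x b) ≤ rho ω (x a) := by
  have h := sub_le_integral_of_ae_deriv_le hab (hx.absolutelyContinuous_rho hω)
    (g := fun _ => 0) continuous_const (by
      filter_upwards [hx.ae_deriv_rho hω hpos] with t ht htab
      obtain ⟨p, -, hp⟩ := ht htab
      rw [hp]
      exact neg_nonpos.2 (abs_nonneg _))
  simpa using h

/-- A normal transported by the coflow stays nearly extremal along a motion. -/
theorem IsMotion.rho_sub_le_inner_coflow {ω : Fin n → ℝ} (hω : ∀ i, ω i ≠ 0) {K : ℝ}
    (hK : ∀ p : Phase n, supportFn ω p = 1 → |inner ℝ (vecB n) p| ≤ K) {a b : ℝ} (hab : a ≤ b)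
    {x : ℝ → Phase n} (hx : IsMotion ω a b x) (hpos : ∀ t ∈ Set.Icc a b, 0 < rho ω (x t))
    {p : Phase n} (hp : IsNormal ω (x a) p) :
    rho ω (x b) - K * (b - a) ≤ inner ℝ (coflow ω (b - a) p) (x b) := by
  have hshift : ∀ t, HasDerivAt (fun t => coflow ω (t - a) p)
      (cogenerator ω (coflow ω (t - a) p)) t := fun t =>
    (hasDerivAt_coflow hω p (t - a)).comp_sub_const t a
  have hac : AbsolutelyContinuousOnInterval
      (fun t => -inner ℝ (coflow ω (t - a) p) (x t)) a b := by
    refine (absolutelyContinuousOnInterval_inner ?_ hx.1).fun_neg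
    exact (((contDiff_coflow ω p).comp (contDiff_id.sub contDiff_const)).contDiffOn
      ).absolutelyContinuousOnInterval
  -- The adjoint flow cancels the drift, so the pairing has derivative `u (B, e^{-(t-a)A*}p)`, at
  -- least `-K`. It starts at `ρ(x(a))`, which is at least `ρ(x(b))` by monotonicity.
  have h := sub_le_integral_of_ae_deriv_le hab hac (g := fun _ => K) continuous_const (by
    filter_upwards [hx.2] with t ht htab
    obtain ⟨u, hu, hxt⟩ := ht htab
    have hu1 := (exists_isNormal_of_mem_feedback hω
      (hpos t (Set.Ioo_subset_Icc_self htab)) hu).1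
    rw [((hshift t).inner ℝ hxt).fun_neg.deriv, inner_cogenerator, inner_add_right,
      inner_smul_right, real_inner_comm]
    have hB := hK (coflow ω (t - a) p) (by rw [supportFn_coflow hω, hp.1])
    have : |u * inner ℝ (vecB n) (coflow ω (t - a) p)| ≤ K := by
      rw [abs_mul]
      exact (mul_le_of_le_one_left (abs_nonneg _) hu1).trans hB
    have := neg_abs_le (u * inner ℝ (vecB n) (coflow ω (t - a) p))
    rw [real_inner_comm] at *
    linarith)
  have hmono := hx.rho_le hω hab hpos
  simp only [sub_self, coflow_zero, hp.2, intervalIntegral.integral_const, smul_eq_mul] at h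
  linarith

/-! ### The uniform drop over unit time -/

/-- Over a unit of time `ρ` drops by a definite amount, as long as it stays large. -/
theorem NonResonant.exists_rho_drop {ω : Fin n → ℝ} (hω : NonResonant ω) :
    ∃ C κ : ℝ, 0 < C ∧ 0 < κ ∧ ∀ (x : ℝ → Phase n) (a : ℝ), IsMotion ω a (a + 1) x →
      (∀ t ∈ Set.Icc a (a + 1), C ≤ rho ω (x t)) →
      rho ω (x (a + 1)) ≤ rho ω (x a) - κ := by
  have hω0 := hω.ne_zero
  obtain ⟨κ, hκ, hobs⟩ := hω.exists_le_integral_abs_inner_coflow one_half_pos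
  obtain ⟨K, hK⟩ : ∃ K, ∀ p : Phase n, supportFn ω p = 1 → |inner ℝ (vecB n) p| ≤ K := by
    obtain ⟨K, hK⟩ := (isCompact_supportFn_eq_one hω0).exists_bound_of_continuousOn
      (f := fun p => inner ℝ (vecB n) p) (by fun_prop)
    exact ⟨K, hK⟩
  -- Normals within `ε` have pairings with `B` differing by at most `κ`; the `+ 1` keeps the
  -- denominator positive even if `B = 0`.
  set ε := κ / (‖vecB n‖ + 1) with hε
  have hBε : ‖vecB n‖ * ε ≤ κ := by
    rw [hε, mul_div_assoc', div_le_iff₀ (by positivity)]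
    nlinarith [norm_nonneg (vecB n)]
  obtain ⟨δ, hδ, hstab⟩ := exists_normal_stability hω0 (by positivity : 0 < ε)
  -- Over unit time the deficit is at most `|K|`; this `C` makes it less than `δ` relative to `ρ`.
  -- Over half a unit the error `κ` integrates to `κ/2`, leaving `κ/2` of the observed `κ`.
  refine ⟨|K| / δ + 1, κ / 2, by positivity, by positivity, fun x a hx hC => ?_⟩
  have hpos : ∀ t ∈ Set.Icc a (a + 1), 0 < rho ω (x t) := fun t ht =>
    (by positivity : 0 < |K| / δ + 1).trans_le (hC t ht)
  -- A normal is supplied only at almost every time, perhaps not at `a`. Choosing `s` in the first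
  -- half leaves room for the half-unit interval `[s, s + 1/2]`; on the rest `ρ` merely does not
  -- increase.
  obtain ⟨s, hs, p, hp⟩ : ∃ s ∈ Set.Ioo a (a + 1 / 2), ∃ p, IsNormal ω (x s) p := by
    by_contra! hcon
    have h0 : ∀ᵐ t : ℝ, t ∉ Set.Ioo a (a + 1 / 2) := by
      filter_upwards [hx.ae_deriv_rho hω0 hpos] with t ht hta
      obtain ⟨p, hp, -⟩ := ht ⟨hta.1, by linarith [hta.2]⟩
      exact hcon t hta p hp
    have h1 : volume (Set.Ioo a (a + 1 / 2)) = 0 := measure_eq_zero_iff_ae_notMem.2 h0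
    rw [Real.volume_Ioo] at h1
    norm_num at h1
  have hsub : ∀ {c d : ℝ}, a ≤ c → d ≤ a + 1 → ∀ t ∈ Set.Icc c d, 0 < rho ω (x t) :=
    fun hc hd t ht => hpos t ⟨hc.trans ht.1, ht.2.trans hd⟩
  have hlast := (hx.mono (c := s + 1 / 2) (d := a + 1) (by linarith [hs.1]) (by linarith [hs.2])
    le_rfl).rho_le hω0 (by linarith [hs.2]) (hsub (by linarith [hs.1]) le_rfl)
  have hfirst := (hx.mono (c := a) (d := s) le_rfl hs.1.le (by linarith [hs.2])).rho_le hω0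
    hs.1.le (hsub le_rfl (by linarith [hs.2]))
  have hmid := hx.mono (c := s) (d := s + 1 / 2) hs.1.le (by linarith) (by linarith [hs.2])
  have hcont : Continuous fun t => |inner ℝ (vecB n) (coflow ω (t - s) p)| :=
    (continuous_const.inner ((contDiff_coflow ω p).continuous.comp
      (continuous_id.sub continuous_const))).abs
  have hdrop := sub_le_integral_of_ae_deriv_le (by linarith)
    (hmid.absolutelyContinuous_rho hω0)
    (g := fun t => κ - |inner ℝ (vecB n) (coflow ω (t - s) p)|) (continuous_const.sub hcont) (by
    filter_upwards [hmid.ae_deriv_rho hω0 (hsub hs.1.le (by linarith [hs.2]))] with t ht hts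
    obtain ⟨q, hq, hder⟩ := ht hts
    have hta : t ∈ Set.Icc a (a + 1) :=
      ⟨by linarith [hs.1, hts.1], by linarith [hs.2, hts.2]⟩
    have hrho := hpos t hta
    have hnear := (hmid.mono (c := s) (d := t) le_rfl hts.1.le hts.2.le).rho_sub_le_inner_coflow
      hω0 hK hts.1.le (hsub hs.1.le hta.2) hp
    have hclose : ‖q - coflow ω (t - s) p‖ < ε := by
      refine hstab _ (inv_rho_smul_mem_body hω0 hrho) _ _ hq.1
        (by rw [supportFn_coflow hω0, hp.1]) ?_ ?_
      · rw [inner_smul_right, hq.2, inv_mul_cancel₀ hrho.ne']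
      · rw [inner_smul_right, inv_mul_eq_div, lt_div_iff₀ hrho]
        have h1 : |K| < δ * rho ω (x t) := by
          have := mul_le_mul_of_nonneg_left (hC t hta) hδ.le
          rw [mul_add, mul_div_cancel₀ _ hδ.ne'] at this
          linarith
        have h2 : K * (t - s) ≤ |K| := by
          have hts' : t - s ≤ 1 := by linarith [hts.2]
          calc K * (t - s) ≤ |K| * (t - s) :=
                mul_le_mul_of_nonneg_right (le_abs_self K) (by linarith [hts.1])
            _ ≤ |K| := mul_le_of_le_one_right (abs_nonneg K) hts'
        linarith
    rw [hder]
    have h3 : |inner ℝ (vecB n) (coflow ω (t - s) p)| - |inner ℝ (vecB n) q| ≤ κ := by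
      calc _ ≤ |inner ℝ (vecB n) (coflow ω (t - s) p) - inner ℝ (vecB n) q| :=
            abs_sub_abs_le_abs_sub _ _
        _ = |inner ℝ (vecB n) (q - coflow ω (t - s) p)| := by rw [abs_sub_comm, inner_sub_right]
        _ ≤ ‖vecB n‖ * ‖q - coflow ω (t - s) p‖ := abs_real_inner_le_norm _ _
        _ ≤ ‖vecB n‖ * ε := by gcongr
        _ ≤ κ := hBε
    linarith)
  rw [intervalIntegral.integral_sub (by simp) (hcont.intervalIntegrable _ _),
    intervalIntegral.integral_const,
    intervalIntegral.integral_comp_sub_right (fun t => |inner ℝ (vecB n) (coflow ω t p)|) s,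
    sub_self, add_sub_cancel_left, smul_eq_mul] at hdrop
  have := hobs p hp.1
  linarith

end Oscillators

end

theorem theorem2 (n : ℕ) (ω : Fin n → ℝ) (hω : Oscillators.NonResonant ω) :
    ∃ C c : ℝ, 0 < C ∧ 0 < c ∧
      ∀ (x : ℝ → Oscillators.Phase n) (a : ℝ) (T : ℕ) (M N : ℝ),
        Oscillators.IsMotion ω a (a + T) x →
        (∀ t ∈ Set.Icc a (a + T), C ≤ Oscillators.rho ω (x t)) →
        Oscillators.rho ω (x a) = M →
        Oscillators.rho ω (x (a + T)) = N →
        (T : ℝ) ≤ c * (M - N) := by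
  obtain ⟨C, κ, hC, hκ, hdrop⟩ := hω.exists_rho_drop
  -- Each unit of time costs at least `κ` of `ρ`, so `c = 1/κ`; the drops add up by induction on
  -- `T`.
  refine ⟨C, κ⁻¹, hC, inv_pos.2 hκ, ?_⟩
  rintro x a T _ _ hx hlarge rfl rfl
  rw [inv_mul_eq_div, le_div_iff₀ hκ]
  induction T with
  | zero => simp
  | succ T ih =>
    push_cast at hx hlarge ⊢
    have hT : (0 : ℝ) ≤ T := T.cast_nonneg
    have h1 := ih (hx.mono le_rfl (by linarith) (by linarith))
      fun t ht => hlarge t ⟨ht.1, by linarith [ht.2]⟩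
    have h2 := hdrop x (a + T) (hx.mono (by linarith) (by linarith) (by linarith))
      fun t ht => hlarge t ⟨by linarith [ht.1], by linarith [ht.2]⟩
    rw [← add_assoc]
    linarith
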